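/- Let $\mathbb{k}$ be a commutative unital ring, $A$ an associative unital $\mathbb{k}$-algebra, and $\Omega^\bullet_d=\bigoplus_{m\ge 0}\Omega^m_d$ an exterior algebra over $A$: a graded $\mathbb{k}$-algebra with $\Omega^0_d=A$ and product $\wedge$, equipped with a $\mathbb{k}$-linear differential $d$ of degree $1$ with $d^2=0$ and $d(\omega\wedge\eta)=d\omega\wedge\eta+(-1)^{\deg\omega}\omega\wedge d\eta$, and generated as an algebra by $A$ and $dA$. For a left $A$-module $N$ write $\Omega^m_dN=\Omega^m_d\otimes_AN$, and for $A$-linear $\varphi$ let $\Omega^m_d(\varphi)=\mathrm{id}\otimes_A\varphi$. Let $J^1_dA$ be the $A$-bimodule $(A\otimes_{\mathbb{k}}A)/\{\sum_i a_i\otimes b_i:\ \sum_i a_ib_i=0,\ \sum_i a_i\,db_i=0\}$, with left action on the first factor and right action on the second; put $J^1_dN=J^1_dA\otimes_AN$, $J^1_d(\varphi)=\mathrm{id}\otimes_A\varphi$, and $\pi^{1,0}_{d,N}:J^1_dN\to N$, $[a\otimes b]\otimes n\mapsto abn$. Let $(\Omega^1_d\ltimes\Omega^2_d)N$ be the group $\Omega^1_dN\oplus\Omega^2_dN$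 with the $A$-action $a\cdot(\alpha,\beta)=(a\alpha,\,da\wedge\alpha+a\beta)$, and let $\widetilde{\mathfrak D}_N=(\widetilde{\mathfrak D}^I_N,\widetilde{\mathfrak D}^{II}_N):J^1_dJ^1_dN\to(\Omega^1_d\ltimes\Omega^2_d)N$ be the $A$-linear map $$[a\otimes b]\otimes[c\otimes c']\otimes n\longmapsto\bigl(a\,d(bc)\,c'\otimes n,\ da\wedge d(bc)\,c'\otimes n\bigr).$$ The holonomic jet modules of a left $A$-module $E$ are $J^0_dE=E$, $J^1_dE=J^1_dA\otimes_AE$ with $l^{1,0}=\mathrm{id}$, and for $n\ge2$ $$J^n_dE=\ker\bigl(\widetilde{\mathfrak D}_{J^{n-2}_dE}\circ J^1_d(l^{1,n-2})\bigr)\subseteq J^1_dJ^{n-1}_dE$$ with inclusion $l^{1,n-1}:J^n_dE\hookrightarrow J^1_dJ^{n-1}_dE$. The jet projections are $\pi^{n,n-1}=\pi^{1,0}_{d,J^{n-1}_dE}\circ l^{1,n-1}:J^n_dE\to J^{n-1}_dE$. The Spencer operators are $$\mathcal S^{n,m}:\Omega^m_dJ^n_dE\to\Omega^{m+1}_dJ^{n-1}_dE,\qquad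 \omega\otimes\xi\mapsto\sum_jd(\omega y_j)z_j\otimes\xi_j\quad\text{for } l^{1,n-1}(\xi)=\sum_j[y_j\otimes z_j]\otimes\xi_j .$$ Let $n\ge1$, and let $C^n$ be an $n$-connection on $E$, i.e. an $A$-linear map $C^n:J^{n-1}_dE\to J^n_dE$ with $\pi^{n,n-1}\circ C^n=\mathrm{id}$. Its curvature is $$R_{C^n}=-\widetilde{\mathfrak D}^{II}_{J^{n-1}_dE}\circ J^1_d(l^{1,n-1})\circ J^1_d(C^n)\circ l^{1,n-1}\circ C^n:J^{n-1}_dE\to\Omega^2_dJ^{n-1}_dE,$$ its associated connection is $\nabla^{C^n}=\mathcal S^{n,0}\circ C^n:J^{n-1}_dE\to\Omega^1_dJ^{n-1}_dE$, and its exterior covariant derivative is $d_{C^n}=\mathcal S^{n,m}\circ\Omega^m_d(C^n):\Omega^m_dJ^{n-1}_dE\to\Omega^{m+1}_dJ^{n-1}_dE$ for $m\ge0$. **Proposition 4.14.** The curvature $R_{C^n}$ of $C^n$ coincides with the curvature $R_{\nabla^{C^n}}:=d_{C^n}\circ\nabla^{C^n}$ of its associated connection. More generally, for all $m\ge0$,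 $\omega\in\Omega^m_d$ and $\xi\in J^{n-1}_dE$, $$d_{C^n}\circ d_{C^n}(\omega\otimes_A\xi)=\omega\wedge R_{C^n}(\xi).$$ -/

import Mathlib

open scoped TensorProduct

universe u v w x

namespace NCJet

section TensorOverRing

/-! ### Tensor product over a (noncommutative) ring

For an `A`-bimodule `M` and a left `A`-module `N`, the left `A`-module `M ⊗_A N`. -/

/-- The subgroup of `M ⊗_ℤ N` generated by all `(m a) ⊗ n - m ⊗ (a n)`; it is stable under the
left action of `A` on `M`. -/
def balancedRel (A : Type u) [Ring A]
    (M : Type v) [AddCommGroup M] [Module A M] [Module Aᵐᵒᵖ M] [SMulCommClass A Aᵐᵒᵖ M]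
    (N : Type w) [AddCommGroup N] [Module A N] : Submodule A (M ⊗[ℤ] N) where
  __ := AddSubgroup.closure
    {t : M ⊗[ℤ] N | ∃ (m : M) (a : A) (n : N),
      t = (MulOpposite.op a • m) ⊗ₜ[ℤ] n - m ⊗ₜ[ℤ] (a • n)}
  smul_mem' := by
    intro c t ht
    change t ∈ AddSubgroup.closure _ at ht
    change c • t ∈ AddSubgroup.closure _
    induction ht using AddSubgroup.closure_induction with
    | mem t ht =>
      obtain ⟨m, a, n, rfl⟩ := ht
      refine AddSubgroup.subset_closure ⟨c • m, a, n, ?_⟩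
      rw [smul_sub, TensorProduct.smul_tmul', TensorProduct.smul_tmul', smul_comm]
    | zero => rw [smul_zero]; exact zero_mem _
    | add s t _ _ hs ht => rw [smul_add]; exact add_mem hs ht
    | neg t _ ht => rw [smul_neg]; exact neg_mem ht

/-- `M ⊗_A N`. -/
def Tensor (A : Type u) [Ring A]
    (M : Type v) [AddCommGroup M] [Module A M] [Module Aᵐᵒᵖ M] [SMulCommClass A Aᵐᵒᵖ M]
    (N : Type w) [AddCommGroup N] [Module A N] : Type (max v w) :=
  (M ⊗[ℤ] N) ⧸ balancedRel A M N

variable {A : Type u} [Ring A]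
variable {M : Type v} [AddCommGroup M] [Module A M] [Module Aᵐᵒᵖ M] [SMulCommClass A Aᵐᵒᵖ M]
variable {M' : Type*} [AddCommGroup M'] [Module A M'] [Module Aᵐᵒᵖ M'] [SMulCommClass A Aᵐᵒᵖ M']
variable {N : Type w} [AddCommGroup N] [Module A N]
variable {N' : Type*} [AddCommGroup N'] [Module A N']

noncomputable instance : AddCommGroup (Tensor A M N) :=
  inferInstanceAs (AddCommGroup ((M ⊗[ℤ] N) ⧸ balancedRel A M N))

noncomputable instance : Module A (Tensor A M N) :=
  inferInstanceAs (Module A ((M ⊗[ℤ] N) ⧸ balancedRel A M N))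

namespace Tensor

variable (A) in
/-- The class `m ⊗_A n`. -/
def tmul (m : M) (n : N) : Tensor A M N :=
  Submodule.Quotient.mk (m ⊗ₜ[ℤ] n)

theorem tmul_add (m : M) (n n' : N) : tmul A m (n + n') = tmul A m n + tmul A m n' :=
  congrArg Submodule.Quotient.mk (TensorProduct.tmul_add m n n')

theorem add_tmul (m m' : M) (n : N) : tmul A (m + m') n = tmul A m n + tmul A m' n :=
  congrArg Submodule.Quotient.mk (TensorProduct.add_tmul m m' n)

@[simp]
theorem tmul_zero (m : M) : tmul A m (0 : N) = 0 :=
  congrArg Submodule.Quotient.mk (TensorProduct.tmul_zero N m)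

@[simp]
theorem zero_tmul (n : N) : tmul A (0 : M) n = 0 :=
  congrArg Submodule.Quotient.mk (TensorProduct.zero_tmul M n)

theorem smul_tmul (a : A) (m : M) (n : N) : a • tmul A m n = tmul A (a • m) n := rfl

theorem op_smul_tmul (a : A) (m : M) (n : N) :
    tmul A (MulOpposite.op a • m) n = tmul A m (a • n) :=
  (Submodule.Quotient.eq _).2 (AddSubgroup.subset_closure ⟨m, a, n, rfl⟩)

@[elab_as_elim]
theorem induction_on {p : Tensor A M N → Prop} (t : Tensor A M N)
    (zero : p 0) (tmul : ∀ m n, p (tmul A m n)) (add : ∀ s t, p s → p t → p (s + t)) : p t := by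
  obtain ⟨t, rfl⟩ := Submodule.Quotient.mk_surjective _ t
  induction t using TensorProduct.induction_on with
  | zero => exact zero
  | tmul m n => exact tmul m n
  | add s t hs ht => exact add _ _ hs ht

/-- The universal property: a balanced biadditive map `M × N → G` induces `M ⊗_A N → G`. -/
noncomputable def lift {G : Type*} [AddCommGroup G] (f : M →+ N →+ G)
    (hf : ∀ (m : M) (a : A) (n : N), f (MulOpposite.op a • m) n = f m (a • n)) :
    Tensor A M N →+ G :=
  QuotientAddGroup.lift (balancedRel A M N).toAddSubgroup
    (TensorProduct.liftAddHom f (fun r m n => by simp))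
    (by
      intro t ht
      change t ∈ AddSubgroup.closure _ at ht
      induction ht using AddSubgroup.closure_induction with
      | mem t ht =>
        obtain ⟨m, a, n, rfl⟩ := ht
        simp [hf]
      | zero => exact zero_mem _
      | add s t _ _ hs ht => exact add_mem hs ht
      | neg t _ ht => exact neg_mem ht)

@[simp]
theorem lift_tmul {G : Type*} [AddCommGroup G] (f : M →+ N →+ G)
    (hf : ∀ (m : M) (a : A) (n : N), f (MulOpposite.op a • m) n = f m (a • n)) (m : M) (n : N) :
    lift f hf (tmul A m n) = f m n := rfl

/-- `m ⊗_A n` as a biadditive map. -/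
noncomputable def tmulHom : M →+ N →+ Tensor A M N :=
  AddMonoidHom.mk' (fun m => AddMonoidHom.mk' (fun n => tmul A m n) (tmul_add m))
    (fun m m' => by ext n; exact add_tmul m m' n)

variable (N) in
/-- `f ⊗_A id : M ⊗_A N → M' ⊗_A N` for a right `A`-linear map `f`. -/
noncomputable def mapLeft (f : M →ₗ[Aᵐᵒᵖ] M') : Tensor A M N →+ Tensor A M' N :=
  lift (tmulHom.comp f.toAddMonoidHom) (fun m a n => by
    change tmul A (f (MulOpposite.op a • m)) n = tmul A (f m) (a • n)
    rw [map_smul, op_smul_tmul])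

@[simp]
theorem mapLeft_tmul (f : M →ₗ[Aᵐᵒᵖ] M') (m : M) (n : N) :
    mapLeft N f (tmul A m n) = tmul A (f m) n := rfl

variable (M) in
/-- `id ⊗_A φ : M ⊗_A N → M ⊗_A N'` for a left `A`-linear map `φ`. -/
noncomputable def mapRight (φ : N →ₗ[A] N') : Tensor A M N →ₗ[A] Tensor A M N' where
  __ := lift (tmulHom.compr₂ (AddMonoidHom.id _) |>.compl₂ φ.toAddMonoidHom) (fun m a n => by
    change tmul A (MulOpposite.op a • m) (φ n) = tmul A m (φ (a • n))
    rw [map_smul, op_smul_tmul])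
  map_smul' a t := by
    induction t using induction_on with
    | zero => simp
    | tmul m n => rfl
    | add s t hs ht => simpa [smul_add] using congrArg₂ (· + ·) hs ht

@[simp]
theorem mapRight_tmul (φ : N →ₗ[A] N') (m : M) (n : N) :
    mapRight M φ (tmul A m n) = tmul A m (φ n) := rfl

end Tensor

end TensorOverRing

/-! ### Exterior algebras over `A` -/

/-- An exterior algebra `Ω^•` over the `k`-algebra `A`: a graded `k`-algebra `Ω` (with grading
`deg`) whose degree zero part is `A`, with a differential `d` of degree one which squares to zero
and satisfies the graded Leibniz rule, such that `Ω` is generated as an algebra by `A` and `dA`. -/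
structure ExteriorCalculus (k : Type x) (A : Type u) (Ω : Type w)
    [CommRing k] [Ring A] [Algebra k A] [Ring Ω] [Algebra k Ω] where
  /-- the homogeneous components -/
  deg : ℕ → Submodule k Ω
  isInternal : DirectSum.IsInternal deg
  mul_mem : ∀ {m p : ℕ} {ω η : Ω}, ω ∈ deg m → η ∈ deg p → ω * η ∈ deg (m + p)
  /-- the identification of `A` with the degree zero part -/
  ofBase : A →ₐ[k] Ω
  ofBase_injective : Function.Injective ofBase
  mem_deg_zero : ∀ ω : Ω, ω ∈ deg 0 ↔ ∃ a : A, ofBase a = ω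
  /-- the differential -/
  d : Ω →ₗ[k] Ω
  d_mem : ∀ {m : ℕ} {ω : Ω}, ω ∈ deg m → d ω ∈ deg (m + 1)
  d_d : ∀ ω : Ω, d (d ω) = 0
  leibniz : ∀ {m : ℕ} {ω : Ω} (η : Ω), ω ∈ deg m →
    d (ω * η) = d ω * η + (-1 : ℤ) ^ m • (ω * d η)
  generated : Algebra.adjoin k (Set.range ofBase ∪ Set.range (fun a => d (ofBase a))) = ⊤

namespace ExteriorCalculus

variable {k : Type x} {A : Type u} {Ω : Type w}
  [CommRing k] [Ring A] [Algebra k A] [Ring Ω] [Algebra k Ω]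
variable (X : ExteriorCalculus k A Ω)

theorem ofBase_mem (a : A) : X.ofBase a ∈ X.deg 0 := (X.mem_deg_zero _).2 ⟨a, rfl⟩

theorem d_ofBase_mul (a b : A) :
    X.d (X.ofBase (a * b)) = X.d (X.ofBase a) * X.ofBase b + X.ofBase a * X.d (X.ofBase b) := by
  rw [map_mul, X.leibniz _ (X.ofBase_mem a)]; simp

theorem d_one : X.d 1 = 0 := by
  have h := X.d_ofBase_mul 1 1
  simpa using h

/-- The `A`-bimodule `Ω^m` of `m`-forms. -/
def Form (m : ℕ) : Type w := X.deg m

namespace Form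

variable {X} {m p : ℕ}

instance : AddCommGroup (X.Form m) := inferInstanceAs (AddCommGroup (X.deg m))

/-- The underlying element of `Ω`. -/
def val : X.Form m →+ Ω := (X.deg m).subtype.toAddMonoidHom

theorem val_injective : Function.Injective (val : X.Form m →+ Ω) := Subtype.val_injective

@[ext]
theorem ext {ω η : X.Form m} (h : ω.val = η.val) : ω = η := val_injective h

theorem val_mem (ω : X.Form m) : ω.val ∈ X.deg m := ω.2

/-- An `m`-form from a homogeneous element of degree `m`. -/
def mk (ω : Ω) (h : ω ∈ X.deg m) : X.Form m := ⟨ω, h⟩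

@[simp]
theorem val_mk (ω : Ω) (h : ω ∈ X.deg m) : (mk ω h : X.Form m).val = ω := rfl

instance : SMul A (X.Form m) :=
  ⟨fun a ω => mk (X.ofBase a * ω.val) (by simpa using X.mul_mem (X.ofBase_mem a) ω.val_mem)⟩

instance : SMul Aᵐᵒᵖ (X.Form m) :=
  ⟨fun a ω => mk (ω.val * X.ofBase a.unop) (X.mul_mem ω.val_mem (X.ofBase_mem a.unop))⟩

@[simp]
theorem val_smul (a : A) (ω : X.Form m) : (a • ω).val = X.ofBase a * ω.val := rfl

@[simp]
theorem val_op_smul (a : Aᵐᵒᵖ) (ω : X.Form m) : (a • ω).val = ω.val * X.ofBase a.unop := rfl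

instance : Module A (X.Form m) where
  one_smul ω := by ext; simp
  mul_smul a b ω := by ext; simp [mul_assoc]
  smul_zero a := by ext; simp
  smul_add a ω η := by ext; simp [mul_add]
  add_smul a b ω := by ext; simp [add_mul]
  zero_smul ω := by ext; simp

instance : Module Aᵐᵒᵖ (X.Form m) where
  one_smul ω := by ext; simp
  mul_smul a b ω := by ext; simp [mul_assoc]
  smul_zero a := by ext; simp
  smul_add a ω η := by ext; simp [add_mul]
  add_smul a b ω := by ext; simp [mul_add]
  zero_smul ω := by ext; simp

instance : SMulCommClass A Aᵐᵒᵖ (X.Form m) where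
  smul_comm a b ω := by ext; simp [mul_assoc]

/-- The unit `1 ∈ A = Ω^0`. -/
instance : One (X.Form 0) := ⟨mk 1 (by simpa using X.ofBase_mem 1)⟩

@[simp]
theorem val_one : (1 : X.Form 0).val = 1 := rfl

/-- `d : Ω^m → Ω^(m+1)`. -/
def diff (m : ℕ) : X.Form m →+ X.Form (m + 1) :=
  AddMonoidHom.mk' (fun ω => mk (X.d ω.val) (X.d_mem ω.val_mem)) (fun ω η => by ext; simp)

@[simp]
theorem val_diff (ω : X.Form m) : (diff m ω).val = X.d ω.val := rfl

variable (X) in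
/-- `d : A → Ω^1`. -/
def diffBase : A →+ X.Form 1 :=
  AddMonoidHom.mk' (fun a => mk (X.d (X.ofBase a)) (X.d_mem (X.ofBase_mem a)))
    (fun a b => by ext; simp)

@[simp]
theorem val_diffBase (a : A) : (diffBase X a).val = X.d (X.ofBase a) := rfl

/-- `η ↦ ω ∧ η`, a right `A`-linear map `Ω^p → Ω^(m+p)`. -/
def wedge (ω : X.Form m) : X.Form p →ₗ[Aᵐᵒᵖ] X.Form (m + p) where
  toFun η := mk (ω.val * η.val) (X.mul_mem ω.val_mem η.val_mem)
  map_add' η θ := by ext; simp [mul_add]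
  map_smul' a η := by ext; simp [mul_assoc]

@[simp]
theorem val_wedge (ω : X.Form m) (η : X.Form p) : (ω.wedge η).val = ω.val * η.val := rfl

end Form

variable (N : Type v) [AddCommGroup N] [Module A N]

/-- `Ω^m N = Ω^m ⊗_A N`. -/
abbrev FormT (m : ℕ) : Type (max w v) := Tensor A (X.Form m) N

variable {X N} in
/-- `η ⊗ n ↦ (ω ∧ η) ⊗ n`, as a map `Ω^p N → Ω^(m+p) N`. -/
noncomputable def wedgeT {m p : ℕ} (ω : X.Form m) : X.FormT N p →+ X.FormT N (m + p) :=
  Tensor.mapLeft N ω.wedge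

theorem wedgeT_tmul {m p : ℕ} (ω : X.Form m) (η : X.Form p) (n : N) :
    wedgeT ω (Tensor.tmul A η n) = Tensor.tmul A (ω.wedge η) n := rfl

/-! ### The first jet functor -/

/-- `A ⊗_k A → Ω^1`, `a ⊗ b ↦ a (d b)`. -/
noncomputable def univMap : A ⊗[k] A →ₗ[k] Ω :=
  TensorProduct.lift
    ((LinearMap.mul k Ω).compl₁₂ X.ofBase.toLinearMap (X.d ∘ₗ X.ofBase.toLinearMap))

@[simp]
theorem univMap_tmul (a b : A) : X.univMap (a ⊗ₜ b) = X.ofBase a * X.d (X.ofBase b) := rfl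

theorem univMap_smul (c : A) (t : A ⊗[k] A) : X.univMap (c • t) = X.ofBase c * X.univMap t := by
  induction t using TensorProduct.induction_on with
  | zero => simp
  | tmul a b => simp [TensorProduct.smul_tmul', mul_assoc]
  | add s t hs ht => simp [smul_add, mul_add, hs, ht]

theorem mul'_smul (c : A) (t : A ⊗[k] A) :
    LinearMap.mul' k A (c • t) = c * LinearMap.mul' k A t := by
  induction t using TensorProduct.induction_on with
  | zero => simp
  | tmul a b => simp [TensorProduct.smul_tmul', mul_assoc]
  | add s t hs ht => simp [smul_add, mul_add, hs, ht]

/-- The kernel `N_d^1` of the map from universal one-forms (the kernel of the multiplication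
`A ⊗_k A → A`) to `Ω^1`; i.e. all `∑ a_i ⊗ b_i` with `∑ a_i b_i = 0` and `∑ a_i (d b_i) = 0`. -/
def N1 : Submodule A (A ⊗[k] A) where
  carrier := {t | LinearMap.mul' k A t = 0 ∧ X.univMap t = 0}
  add_mem' hs ht := ⟨by rw [map_add, hs.1, ht.1, add_zero], by rw [map_add, hs.2, ht.2, add_zero]⟩
  zero_mem' := ⟨map_zero _, map_zero _⟩
  smul_mem' c t ht := ⟨by rw [mul'_smul, ht.1, mul_zero], by rw [univMap_smul, ht.2, mul_zero]⟩

/-- The `A`-bimodule `J^1 A = (A ⊗_k A) / N_d^1`. -/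
def J1A : Type u := (A ⊗[k] A) ⧸ X.N1

namespace J1A

noncomputable instance : AddCommGroup X.J1A := inferInstanceAs (AddCommGroup ((A ⊗[k] A) ⧸ X.N1))

/-- The left action `c [a ⊗ b] = [c a ⊗ b]`. -/
noncomputable instance : Module A X.J1A := inferInstanceAs (Module A ((A ⊗[k] A) ⧸ X.N1))

variable (k) in
/-- `a ⊗ b ↦ a ⊗ b c` on `A ⊗_k A`. -/
noncomputable def rightMul (c : A) : A ⊗[k] A →ₗ[A] A ⊗[k] A :=
  TensorProduct.AlgebraTensorModule.map LinearMap.id (LinearMap.mulRight k c)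

theorem rightMul_tmul (c a b : A) : rightMul k c (a ⊗ₜ[k] b) = a ⊗ₜ[k] (b * c) := rfl

theorem mul'_rightMul (c : A) (t : A ⊗[k] A) :
    LinearMap.mul' k A (rightMul k c t) = LinearMap.mul' k A t * c := by
  induction t using TensorProduct.induction_on with
  | zero => simp
  | tmul a b => simp [rightMul_tmul, mul_assoc]
  | add s t hs ht => simp [add_mul, hs, ht]

theorem univMap_rightMul (c : A) (t : A ⊗[k] A) :
    X.univMap (rightMul k c t) =
      X.univMap t * X.ofBase c + X.ofBase (LinearMap.mul' k A t) * X.d (X.ofBase c) := by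
  induction t using TensorProduct.induction_on with
  | zero => simp
  | tmul a b =>
    rw [rightMul_tmul, univMap_tmul, univMap_tmul, d_ofBase_mul, LinearMap.mul'_apply, map_mul,
      mul_add, mul_assoc, mul_assoc]
  | add s t hs ht =>
    simp only [map_add, hs, ht]
    noncomm_ring

/-- Right multiplication by `c` on `J^1 A`. -/
noncomputable def rightAct (c : A) : X.J1A →ₗ[A] X.J1A :=
  Submodule.mapQ X.N1 X.N1 (rightMul k c) (fun t ht =>
    ⟨by rw [mul'_rightMul, ht.1, zero_mul], by rw [univMap_rightMul, ht.1, ht.2]; simp⟩)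

/-- The class `[a ⊗ b]`. -/
def cls (a b : A) : X.J1A := Submodule.Quotient.mk (a ⊗ₜ[k] b)

variable {X} in
@[elab_as_elim]
theorem induction_on {p : X.J1A → Prop} (t : X.J1A)
    (zero : p 0) (cls : ∀ a b, p (cls X a b)) (add : ∀ s t, p s → p t → p (s + t)) : p t := by
  obtain ⟨t, rfl⟩ := Submodule.Quotient.mk_surjective _ t
  induction t using TensorProduct.induction_on with
  | zero => exact zero
  | tmul a b => exact cls a b
  | add s t hs ht => exact add _ _ hs ht

/-- The right action `[a ⊗ b] c = [a ⊗ b c]`. -/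
noncomputable instance : SMul Aᵐᵒᵖ X.J1A := ⟨fun c t => rightAct X c.unop t⟩

theorem op_smul_def (c : Aᵐᵒᵖ) (t : X.J1A) : c • t = rightAct X c.unop t := rfl

theorem op_smul_cls (c : Aᵐᵒᵖ) (a b : A) : c • cls X a b = cls X a (b * c.unop) := rfl

theorem smul_cls (c a b : A) : c • cls X a b = cls X (c * a) b := rfl

theorem cls_add (a b b' : A) : cls X a (b + b') = cls X a b + cls X a b' :=
  congrArg Submodule.Quotient.mk (TensorProduct.tmul_add a b b')

theorem cls_zero (a : A) : cls X a 0 = 0 :=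
  congrArg Submodule.Quotient.mk (TensorProduct.tmul_zero A a)

noncomputable instance : Module Aᵐᵒᵖ X.J1A where
  one_smul t := by
    induction t using induction_on with
    | zero => exact map_zero _
    | cls a b => simp [op_smul_cls]
    | add s t hs ht => simpa [op_smul_def] using congrArg₂ (· + ·) hs ht
  mul_smul c e t := by
    induction t using induction_on with
    | zero => simp [op_smul_def]
    | cls a b => simp [op_smul_cls, mul_assoc]
    | add s t hs ht => simpa [op_smul_def] using congrArg₂ (· + ·) hs ht
  smul_zero c := map_zero _
  smul_add c := map_add _
  add_smul c e t := by
    induction t using induction_on with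
    | zero => simp [op_smul_def]
    | cls a b => simp [op_smul_cls, mul_add, cls_add]
    | add s t hs ht =>
      simp only [op_smul_def, map_add] at hs ht ⊢
      rw [hs, ht]; abel
  zero_smul t := by
    induction t using induction_on with
    | zero => simp [op_smul_def]
    | cls a b => simp [op_smul_cls, cls_zero]
    | add s t hs ht => simpa [op_smul_def] using congrArg₂ (· + ·) hs ht

instance : SMulCommClass A Aᵐᵒᵖ X.J1A where
  smul_comm a c t := (map_smul (rightAct X c.unop) a t).symm

/-- Additive maps out of `J^1 A`: an additive map out of `A ⊗_k A` which vanishes on `N_d^1`. -/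
noncomputable def lift {G : Type*} [AddCommGroup G] (f : A ⊗[k] A →+ G)
    (hf : ∀ t, LinearMap.mul' k A t = 0 → X.univMap t = 0 → f t = 0) : X.J1A →+ G :=
  QuotientAddGroup.lift X.N1.toAddSubgroup f (fun t ht => hf t ht.1 ht.2)

@[simp]
theorem lift_cls {G : Type*} [AddCommGroup G] (f : A ⊗[k] A →+ G)
    (hf : ∀ t, LinearMap.mul' k A t = 0 → X.univMap t = 0 → f t = 0) (a b : A) :
    lift X f hf (cls X a b) = f (a ⊗ₜ b) := rfl

end J1A

/-- The first jet functor on objects: `J^1 N = J^1 A ⊗_A N`. -/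
abbrev J1 : Type (max u v) := Tensor A X.J1A N

variable {N} in
/-- The first jet functor on morphisms. -/
noncomputable def J1map {N' : Type*} [AddCommGroup N'] [Module A N'] (φ : N →ₗ[A] N') :
    X.J1 N →ₗ[A] X.J1 N' :=
  Tensor.mapRight X.J1A φ

/-- `J^1 A → A`, `[a ⊗ b] ↦ a b`. -/
noncomputable def J1Aproj : X.J1A →+ A :=
  J1A.lift X (LinearMap.mul' k A).toAddMonoidHom (fun _ h _ => h)

@[simp]
theorem J1Aproj_cls (a b : A) : X.J1Aproj (J1A.cls X a b) = a * b := rfl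

theorem J1Aproj_op_smul (t : X.J1A) (c : A) :
    X.J1Aproj (MulOpposite.op c • t) = X.J1Aproj t * c := by
  induction t using J1A.induction_on with
  | zero => simp
  | cls a b => simp [J1A.op_smul_cls, mul_assoc]
  | add s t hs ht => simp [add_mul, hs, ht]

theorem J1Aproj_smul (t : X.J1A) (c : A) : X.J1Aproj (c • t) = c * X.J1Aproj t := by
  induction t using J1A.induction_on with
  | zero => simp
  | cls a b => simp [J1A.smul_cls, mul_assoc]
  | add s t hs ht => simp [mul_add, hs, ht]

/-- The jet projection `π^{1,0} : J^1 N → N`, `[a ⊗ b] ⊗ n ↦ a b n`. -/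
noncomputable def proj10 : X.J1 N →ₗ[A] N where
  __ := Tensor.lift
    ((AddMonoidHom.mk' (fun t : X.J1A => DistribSMul.toAddMonoidHom N (X.J1Aproj t))
      (fun s t => by ext n; simp [add_smul])))
    (fun t c n => by
      change X.J1Aproj (MulOpposite.op c • t) • n = X.J1Aproj t • c • n
      rw [J1Aproj_op_smul, mul_smul])
  map_smul' c t := by
    induction t using Tensor.induction_on with
    | zero => simp
    | tmul t n =>
      change X.J1Aproj (c • t) • n = c • X.J1Aproj t • n
      rw [J1Aproj_smul, mul_smul]
    | add s t hs ht => simpa [smul_add] using congrArg₂ (· + ·) hs ht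

theorem proj10_cls (a b : A) (n : N) :
    X.proj10 N (Tensor.tmul A (J1A.cls X a b) n) = (a * b) • n := rfl

/-! ### The first Spencer operators -/

/-- For an `m`-form `ω`, the map `A ⊗_k A → Ω^(m+1)`, `y ⊗ z ↦ d(ω y) z`. -/
noncomputable def spencerPre {m : ℕ} (ω : X.Form m) : A ⊗[k] A →+ X.Form (m + 1) :=
  TensorProduct.liftAddHom
    (AddMonoidHom.mk' (fun y => AddMonoidHom.mk'
        (fun z => MulOpposite.op z • Form.diff m (MulOpposite.op y • ω))
        (fun z z' => by ext; simp [mul_add]))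
      (fun y y' => by ext z; simp [mul_add, add_mul]))
    (fun r y z => by ext; simp)

theorem val_spencerPre_tmul {m : ℕ} (ω : X.Form m) (y z : A) :
    (X.spencerPre ω (y ⊗ₜ z)).val = X.d (ω.val * X.ofBase y) * X.ofBase z := rfl

theorem val_spencerPre {m : ℕ} (ω : X.Form m) (t : A ⊗[k] A) :
    (X.spencerPre ω t).val = X.d ω.val * X.ofBase (LinearMap.mul' k A t) +
      (-1 : ℤ) ^ m • (ω.val * (X.d (X.ofBase (LinearMap.mul' k A t)) - X.univMap t)) := by
  induction t using TensorProduct.induction_on with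
  | zero => simp
  | tmul a b =>
    rw [val_spencerPre_tmul, X.leibniz _ ω.val_mem, LinearMap.mul'_apply, univMap_tmul,
      d_ofBase_mul, map_mul, add_sub_cancel_right, add_mul, smul_mul_assoc]
    simp only [mul_assoc]
  | add s t hs ht =>
    simp only [map_add, hs, ht, mul_add, mul_sub, smul_add, smul_sub]
    abel

/-- For an `m`-form `ω`, the right `A`-linear map `J^1 A → Ω^(m+1)`, `[y ⊗ z] ↦ d(ω y) z`. -/
noncomputable def spencerA {m : ℕ} (ω : X.Form m) : X.J1A →ₗ[Aᵐᵒᵖ] X.Form (m + 1) where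
  __ := J1A.lift X (X.spencerPre ω) (fun t h h' => by ext; rw [val_spencerPre, h, h']; simp)
  map_smul' c t := by
    induction t using J1A.induction_on with
    | zero => simp
    | cls a b =>
      ext
      change X.d (ω.val * X.ofBase a) * X.ofBase (b * c.unop) =
        X.d (ω.val * X.ofBase a) * X.ofBase b * X.ofBase c.unop
      rw [map_mul X.ofBase, mul_assoc]
    | add s t hs ht => simpa [smul_add] using congrArg₂ (· + ·) hs ht

theorem val_spencerA_cls {m : ℕ} (ω : X.Form m) (y z : A) :
    (X.spencerA ω (J1A.cls X y z)).val = X.d (ω.val * X.ofBase y) * X.ofBase z := rfl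

theorem spencerA_add {m : ℕ} (ω η : X.Form m) (t : X.J1A) :
    X.spencerA (ω + η) t = X.spencerA ω t + X.spencerA η t := by
  induction t using J1A.induction_on with
  | zero => simp
  | cls a b => ext; simp [val_spencerA_cls, add_mul]
  | add s t hs ht => simp only [map_add, hs, ht]; abel

theorem spencerA_op_smul {m : ℕ} (ω : X.Form m) (a : A) (t : X.J1A) :
    X.spencerA (MulOpposite.op a • ω) t = X.spencerA ω (a • t) := by
  induction t using J1A.induction_on with
  | zero => simp
  | cls y z => ext; simp [val_spencerA_cls, J1A.smul_cls, mul_assoc]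
  | add s t hs ht => simp only [map_add, smul_add, hs, ht]

/-- The Spencer operator `S^{1,m} : Ω^m J^1 N → Ω^(m+1) N`,
`ω ⊗ [y ⊗ z] ⊗ n ↦ d(ω y) z ⊗ n`. -/
noncomputable def spencer1 (m : ℕ) : X.FormT (X.J1 N) m →+ X.FormT N (m + 1) :=
  Tensor.lift
    (AddMonoidHom.mk' (fun ω => Tensor.mapLeft N (X.spencerA ω)) (fun ω η => by
      ext t
      induction t using Tensor.induction_on with
      | zero => simp
      | tmul t n =>
        simp only [AddMonoidHom.add_apply, Tensor.mapLeft_tmul, spencerA_add, Tensor.add_tmul]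
      | add s t hs ht => simp only [map_add, hs, ht]))
    (fun ω a t => by
      change Tensor.mapLeft N (X.spencerA (MulOpposite.op a • ω)) t =
        Tensor.mapLeft N (X.spencerA ω) (a • t)
      induction t using Tensor.induction_on with
      | zero => simp
      | tmul t n =>
        simp only [Tensor.smul_tmul, Tensor.mapLeft_tmul, spencerA_op_smul]
      | add s t hs ht => simp only [map_add, smul_add, hs, ht])

theorem spencer1_tmul (m : ℕ) (ω : X.Form m) (y z : A) (n : N) :
    X.spencer1 N m (Tensor.tmul A ω (Tensor.tmul A (J1A.cls X y z) n)) =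
      Tensor.tmul A (MulOpposite.op z • Form.diff m (MulOpposite.op y • ω)) n := rfl

/-- `[y ⊗ z] ⊗ n ↦ (d y) z ⊗ n`, as a map `J^1 N → Ω^1 N` (the Spencer operator `S^{1,0}`, which is
minus the usual projection `ρ : J^1 N → Ω^1 N`). -/
noncomputable def sigma : X.J1 N →+ X.FormT N 1 :=
  Tensor.mapLeft N (X.spencerA (1 : X.Form 0))

theorem sigma_cls (y z : A) (n : N) :
    X.sigma N (Tensor.tmul A (J1A.cls X y z) n) =
      Tensor.tmul A (MulOpposite.op z • Form.diffBase X y) n := by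
  change Tensor.tmul A (X.spencerA (1 : X.Form 0) (J1A.cls X y z)) n = _
  congr 1
  ext
  rw [val_spencerA_cls]
  simp

theorem sigma_smul (a : A) (t : X.J1 N) :
    X.sigma N (a • t) = a • X.sigma N t + Tensor.tmul A (Form.diffBase X a) (X.proj10 N t) := by
  induction t using Tensor.induction_on with
  | zero => simp
  | tmul t n =>
    induction t using J1A.induction_on with
    | zero => simp
    | cls y z =>
      rw [Tensor.smul_tmul, J1A.smul_cls, sigma_cls, sigma_cls, proj10_cls, Tensor.smul_tmul,
        ← Tensor.op_smul_tmul, ← Tensor.add_tmul]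
      congr 1
      ext
      rw [map_add, Form.val_op_smul, Form.val_smul, Form.val_op_smul, Form.val_op_smul,
        Form.val_diffBase, Form.val_diffBase, Form.val_diffBase, d_ofBase_mul, MulOpposite.unop_op,
        MulOpposite.unop_op, map_mul X.ofBase, add_mul, mul_assoc, mul_assoc, add_comm]
    | add s t hs ht =>
      rw [Tensor.add_tmul, smul_add, map_add, map_add, map_add, hs, ht, smul_add, Tensor.tmul_add]
      abel
  | add s t hs ht =>
    rw [smul_add, map_add, map_add, map_add, hs, ht, smul_add, Tensor.tmul_add]
    abel

theorem diffBase_algebraMap (r : k) : Form.diffBase X (algebraMap k A r) = 0 := by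
  ext
  rw [Form.val_diffBase, AlgHom.commutes, Algebra.algebraMap_eq_smul_one, map_smul, d_one,
    smul_zero, map_zero]

theorem sigma_smul_algebraMap (r : k) (t : X.J1 N) :
    X.sigma N (algebraMap k A r • t) = algebraMap k A r • X.sigma N t := by
  rw [sigma_smul, diffBase_algebraMap, Tensor.zero_tmul, add_zero]

/-! ### The operator `D̃ : J^1 J^1 N → (Ω^1 ⋉ Ω^2) N` -/

variable {X N} in
theorem wedgeT_add {m p : ℕ} (ω η : X.Form m) (t : X.FormT N p) :
    wedgeT (ω + η) t = wedgeT ω t + wedgeT η t := by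
  induction t using Tensor.induction_on with
  | zero => simp
  | tmul θ n =>
    rw [wedgeT_tmul, wedgeT_tmul, wedgeT_tmul, ← Tensor.add_tmul]
    congr 1
    ext
    simp [add_mul]
  | add s t hs ht => simp only [map_add, hs, ht]; abel

variable {X N} in
theorem wedgeT_op_smul {m p : ℕ} (ω : X.Form m) (a : A) (t : X.FormT N p) :
    wedgeT (MulOpposite.op a • ω) t = wedgeT ω (a • t) := by
  induction t using Tensor.induction_on with
  | zero => simp
  | tmul θ n =>
    rw [Tensor.smul_tmul, wedgeT_tmul, wedgeT_tmul]
    congr 1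
    ext
    simp [mul_assoc]
  | add s t hs ht => simp only [map_add, smul_add, hs, ht]

variable {X N} in
theorem wedgeT_smul {m p : ℕ} (ω : X.Form m) (a : A) (t : X.FormT N p) :
    wedgeT (a • ω) t = a • wedgeT ω t := by
  induction t using Tensor.induction_on with
  | zero => simp
  | tmul θ n =>
    rw [wedgeT_tmul, wedgeT_tmul, Tensor.smul_tmul]
    congr 1
    ext
    simp [mul_assoc]
  | add s t hs ht => simp only [map_add, smul_add, hs, ht]

/-- The left `A`-module `(Ω^1 ⋉ Ω^2) N`: the group `Ω^1 N ⊕ Ω^2 N` with the twisted action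
`a (α, β) = (a α, da ∧ α + a β)`. -/
def SemiForm : Type (max w v) := X.FormT N 1 × X.FormT N 2

noncomputable instance : AddCommGroup (X.SemiForm N) :=
  inferInstanceAs (AddCommGroup (X.FormT N 1 × X.FormT N 2))

variable {X N} in
/-- `d a ∧ α ∈ Ω^2 N` for `a ∈ A` and `α ∈ Ω^1 N`. -/
noncomputable def dWedge (a : A) : X.FormT N 1 →+ X.FormT N 2 :=
  wedgeT (m := 1) (p := 1) (Form.diffBase X a)

variable {X N} in
theorem dWedge_add (a b : A) (t : X.FormT N 1) :
    dWedge (a + b) t = dWedge a t + dWedge b t := by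
  unfold dWedge
  rw [map_add, wedgeT_add]

variable {X N} in
theorem dWedge_mul (a b : A) (t : X.FormT N 1) :
    dWedge (a * b) t = dWedge a (b • t) + a • dWedge b t := by
  unfold dWedge
  rw [← wedgeT_op_smul, ← wedgeT_smul, ← wedgeT_add]
  congr 2
  ext
  exact X.d_ofBase_mul a b

variable {X N} in
theorem dWedge_algebraMap (r : k) (t : X.FormT N 1) : dWedge (algebraMap k A r) t = 0 := by
  unfold dWedge
  rw [diffBase_algebraMap, ← zero_smul A (0 : X.Form 1), wedgeT_smul, zero_smul]

noncomputable instance : Module A (X.SemiForm N) where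
  smul a t := (a • t.1, dWedge a t.1 + a • t.2)
  one_smul t := by
    refine Prod.ext (one_smul A t.1) ?_
    change dWedge 1 t.1 + (1 : A) • t.2 = t.2
    rw [← map_one (algebraMap k A), dWedge_algebraMap, map_one, one_smul, zero_add]
  mul_smul a b t := by
    refine Prod.ext (mul_smul a b t.1) ?_
    change dWedge (a * b) t.1 + (a * b) • t.2 = dWedge a (b • t.1) + a • (dWedge b t.1 + b • t.2)
    rw [dWedge_mul, smul_add, mul_smul, add_assoc]
  smul_zero a := by
    refine Prod.ext (smul_zero a) ?_
    change dWedge a 0 + a • (0 : X.FormT N 2) = 0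
    simp
  smul_add a s t := by
    refine Prod.ext (smul_add a s.1 t.1) ?_
    change dWedge a (s.1 + t.1) + a • (s.2 + t.2) =
      (dWedge a s.1 + a • s.2) + (dWedge a t.1 + a • t.2)
    rw [map_add, smul_add]; abel
  add_smul a b t := by
    refine Prod.ext (add_smul a b t.1) ?_
    change dWedge (a + b) t.1 + (a + b) • t.2 = (dWedge a t.1 + a • t.2) + (dWedge b t.1 + b • t.2)
    rw [dWedge_add, add_smul]; abel
  zero_smul t := by
    refine Prod.ext (zero_smul A t.1) ?_
    change dWedge 0 t.1 + (0 : A) • t.2 = 0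
    rw [← map_zero (algebraMap k A), dWedge_algebraMap, map_zero, zero_smul, zero_add]

theorem univMap_mem (t : A ⊗[k] A) : X.univMap t ∈ X.deg 1 := by
  induction t using TensorProduct.induction_on with
  | zero => rw [map_zero]; exact zero_mem _
  | tmul a b =>
    have h := X.mul_mem (X.ofBase_mem a) (X.d_mem (X.ofBase_mem b))
    simpa using h
  | add s t hs ht => rw [map_add]; exact add_mem hs ht

/-- `a ⊗ b ↦ a (d b)` as a map into `Ω^1`. -/
noncomputable def univForm : A ⊗[k] A →+ X.Form 1 :=
  AddMonoidHom.mk' (fun t => Form.mk (X.univMap t) (X.univMap_mem t)) (fun s t => by ext; simp)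

variable {N} in
/-- For `ξ ∈ J^1 N`, the map `A ⊗_k A → Ω^1 N`, `a ⊗ b ↦ a sigma(b ξ)`. -/
noncomputable def dTildePreI (ξ : X.J1 N) : A ⊗[k] A →+ X.FormT N 1 :=
  TensorProduct.liftAddHom
    (AddMonoidHom.mk' (fun a => AddMonoidHom.mk' (fun b => a • X.sigma N (b • ξ))
        (fun b b' => by simp only [add_smul, map_add, smul_add]))
      (fun a a' => by ext b; simp [add_smul]))
    (fun r a b => by
      change (r • a) • X.sigma N (b • ξ) = a • X.sigma N ((r • b) • ξ)
      rw [Algebra.smul_def r b, mul_smul, sigma_smul_algebraMap, ← mul_smul, Algebra.smul_def,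
        Algebra.commutes])

variable {N} in
theorem dTildePreI_tmul (ξ : X.J1 N) (a b : A) :
    X.dTildePreI ξ (a ⊗ₜ b) = a • X.sigma N (b • ξ) := rfl

variable {N} in
theorem dTildePreI_eq (ξ : X.J1 N) (t : A ⊗[k] A) :
    X.dTildePreI ξ t = Tensor.tmul A (X.univForm t) (X.proj10 N ξ) +
      LinearMap.mul' k A t • X.sigma N ξ := by
  induction t using TensorProduct.induction_on with
  | zero => simp
  | tmul a b =>
    rw [dTildePreI_tmul, sigma_smul, smul_add, ← mul_smul, Tensor.smul_tmul, add_comm]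
    rfl
  | add s t hs ht => simp only [map_add, hs, ht, Tensor.add_tmul, add_smul]; abel

variable {N} in
/-- For `ξ ∈ J^1 N`, the map `A ⊗_k A → Ω^2 N`, `a ⊗ b ↦ da ∧ sigma(b ξ)`. -/
noncomputable def dTildePreII (ξ : X.J1 N) : A ⊗[k] A →+ X.FormT N 2 :=
  TensorProduct.liftAddHom
    (AddMonoidHom.mk' (fun a => AddMonoidHom.mk' (fun b => dWedge a (X.sigma N (b • ξ)))
        (fun b b' => by simp only [add_smul, map_add]))
      (fun a a' => by ext b; simp [dWedge_add]))
    (fun r a b => by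
      change dWedge (r • a) (X.sigma N (b • ξ)) = dWedge a (X.sigma N ((r • b) • ξ))
      rw [Algebra.smul_def r b, mul_smul, sigma_smul_algebraMap, Algebra.smul_def,
        Algebra.commutes, dWedge_mul, dWedge_algebraMap, smul_zero, add_zero])

variable {N} in
theorem dTildePreII_tmul (ξ : X.J1 N) (a b : A) :
    X.dTildePreII ξ (a ⊗ₜ b) = dWedge a (X.sigma N (b • ξ)) := rfl

variable {N} in
theorem dTildePreII_eq (ξ : X.J1 N) (t : A ⊗[k] A) :
    X.dTildePreII ξ t = Tensor.tmul A (Form.diff 1 (X.univForm t)) (X.proj10 N ξ) +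
      (dWedge (LinearMap.mul' k A t) (X.sigma N ξ) -
        wedgeT (m := 1) (p := 1) (X.univForm t) (X.sigma N ξ)) := by
  induction t using TensorProduct.induction_on with
  | zero =>
    have h : wedgeT (m := 1) (p := 1) (0 : X.Form 1) (X.sigma N ξ) = 0 := by
      rw [← zero_smul A (0 : X.Form 1), wedgeT_smul, zero_smul]
    have h' : dWedge (0 : A) (X.sigma N ξ) = 0 := by
      rw [← map_zero (algebraMap k A), dWedge_algebraMap]
    simp only [map_zero, h', Tensor.zero_tmul]
    rw [h]
    simp
  | tmul a b =>
    have h1 : X.univForm (a ⊗ₜ b) = a • Form.diffBase X b := rfl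
    have h2 : Form.diff 1 (a • Form.diffBase X b) =
        (Form.diffBase X a).wedge (Form.diffBase X b) := by
      ext
      simp [X.leibniz _ (X.ofBase_mem a), X.d_d, Form.val_wedge (p := 1)]
    rw [dTildePreII_tmul, sigma_smul, map_add, LinearMap.mul'_apply, dWedge_mul, h1, wedgeT_smul,
      h2]
    change _ + wedgeT (m := 1) (p := 1) _ (Tensor.tmul A _ _) = _
    rw [wedgeT_tmul]
    change _ = _ + (dWedge a (b • X.sigma N ξ) + a • dWedge b (X.sigma N ξ) -
      a • dWedge b (X.sigma N ξ))
    rw [add_sub_cancel_right, add_comm]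
  | add s t hs ht =>
    simp only [map_add, hs, ht, Tensor.add_tmul, dWedge_add, wedgeT_add]
    abel

/-- The first component of `D̃`: `[a ⊗ b] ⊗ ξ ↦ a sigma(b ξ)`, that is
`[a ⊗ b] ⊗ [c ⊗ c'] ⊗ n ↦ a d(b c) c' ⊗ n`. -/
noncomputable def dTildeI : X.J1 (X.J1 N) →+ X.FormT N 1 :=
  Tensor.lift
    (AddMonoidHom.mk' (fun t => AddMonoidHom.mk' (fun ξ => J1A.lift X (X.dTildePreI ξ)
          (fun t h h' => by
            have h0 : X.univForm t = 0 := by ext; exact h'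
            rw [dTildePreI_eq, h, h0]; simp) t)
        (fun ξ η => by
          induction t using J1A.induction_on with
          | zero => simp
          | cls a b => simp [dTildePreI_tmul]
          | add s t hs ht => simp only [map_add, hs, ht]; abel))
      (fun s t => by ext ξ; simp))
    (fun t c ξ => by
      induction t using J1A.induction_on with
      | zero => simp
      | cls a b =>
        change a • X.sigma N ((b * c) • ξ) = a • X.sigma N (b • c • ξ)
        rw [mul_smul]
      | add s t hs ht => simpa [smul_add] using congrArg₂ (· + ·) hs ht)

theorem dTildeI_cls (a b : A) (ξ : X.J1 N) :
    X.dTildeI N (Tensor.tmul A (J1A.cls X a b) ξ) = a • X.sigma N (b • ξ) := rfl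

/-- The second component `D̃^II` of `D̃`: `[a ⊗ b] ⊗ ξ ↦ da ∧ sigma(b ξ)`, that is
`[a ⊗ b] ⊗ [c ⊗ c'] ⊗ n ↦ da ∧ d(b c) c' ⊗ n`. -/
noncomputable def dTildeII : X.J1 (X.J1 N) →+ X.FormT N 2 :=
  Tensor.lift
    (AddMonoidHom.mk' (fun t => AddMonoidHom.mk' (fun ξ => J1A.lift X (X.dTildePreII ξ)
          (fun t h h' => by
            have h0 : X.univForm t = 0 := by ext; exact h'
            have h1 : wedgeT (m := 1) (p := 1) (0 : X.Form 1) (X.sigma N ξ) = 0 := by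
              rw [← zero_smul A (0 : X.Form 1), wedgeT_smul, zero_smul]
            have h2 : dWedge (0 : A) (X.sigma N ξ) = 0 := by
              rw [← map_zero (algebraMap k A), dWedge_algebraMap]
            rw [dTildePreII_eq, h, h0, h1, h2, map_zero, Tensor.zero_tmul, sub_zero, add_zero]) t)
        (fun ξ η => by
          induction t using J1A.induction_on with
          | zero => simp
          | cls a b => simp [dTildePreII_tmul]
          | add s t hs ht => simp only [map_add, hs, ht]; abel))
      (fun s t => by ext ξ; simp))
    (fun t c ξ => by
      induction t using J1A.induction_on with
      | zero => simp
      | cls a b =>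
        change dWedge a (X.sigma N ((b * c) • ξ)) = dWedge a (X.sigma N (b • c • ξ))
        rw [mul_smul]
      | add s t hs ht => simpa [smul_add] using congrArg₂ (· + ·) hs ht)

theorem dTildeII_cls (a b : A) (ξ : X.J1 N) :
    X.dTildeII N (Tensor.tmul A (J1A.cls X a b) ξ) = dWedge a (X.sigma N (b • ξ)) := rfl

/-- The left `A`-linear map `D̃ = (D̃^I, D̃^II) : J^1 J^1 N → (Ω^1 ⋉ Ω^2) N`. -/
noncomputable def dTilde : X.J1 (X.J1 N) →ₗ[A] X.SemiForm N where
  toFun t := (X.dTildeI N t, X.dTildeII N t)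
  map_add' s t := Prod.ext (map_add _ s t) (map_add _ s t)
  map_smul' c t := by
    change (X.dTildeI N (c • t), X.dTildeII N (c • t)) =
      (c • X.dTildeI N t, dWedge c (X.dTildeI N t) + c • X.dTildeII N t)
    induction t using Tensor.induction_on with
    | zero => simp
    | tmul t ξ =>
      induction t using J1A.induction_on with
      | zero => simp
      | cls a b =>
        rw [Tensor.smul_tmul, J1A.smul_cls, dTildeI_cls, dTildeI_cls, dTildeII_cls, dTildeII_cls,
          mul_smul, dWedge_mul]
      | add s t hs ht =>
        obtain ⟨hs1, hs2⟩ := Prod.ext_iff.1 hs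
        obtain ⟨ht1, ht2⟩ := Prod.ext_iff.1 ht
        dsimp only at hs1 hs2 ht1 ht2
        simp only [Tensor.add_tmul, smul_add, map_add, hs1, hs2, ht1, ht2]
        refine Prod.ext rfl ?_
        dsimp only
        abel
    | add s t hs ht =>
      obtain ⟨hs1, hs2⟩ := Prod.ext_iff.1 hs
      obtain ⟨ht1, ht2⟩ := Prod.ext_iff.1 ht
      dsimp only at hs1 hs2 ht1 ht2
      simp only [smul_add, map_add, hs1, hs2, ht1, ht2]
      refine Prod.ext rfl ?_
      dsimp only
      abel

/-! ### Holonomic jets -/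

/-- Two consecutive jet modules `lower = J^n E` and `upper = J^(n+1) E`, with the natural map
`incl = l^{1,n} : J^(n+1) E → J^1 J^n E`. -/
structure JetStage where
  /-- `J^n E` -/
  lower : Type (max u v)
  [groupLower : AddCommGroup lower]
  [moduleLower : Module A lower]
  /-- `J^(n+1) E` -/
  upper : Type (max u v)
  [groupUpper : AddCommGroup upper]
  [moduleUpper : Module A upper]
  /-- `l^{1,n}` -/
  incl : upper →ₗ[A] X.J1 lower

attribute [instance] JetStage.groupLower JetStage.moduleLower JetStage.groupUpper
  JetStage.moduleUpper

variable {X} in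
/-- The passage from `(J^n, J^(n+1), l^{1,n})` to `(J^(n+1), J^(n+2), l^{1,n+1})`: the module
`J^(n+2) E` is the kernel of `D̃ ∘ J^1(l^{1,n}) : J^1 J^(n+1) E → J^1 J^1 J^n E → (Ω^1 ⋉ Ω^2) J^n E`
and `l^{1,n+1}` is its inclusion into `J^1 J^(n+1) E`. -/
noncomputable def JetStage.next (s : JetStage.{u, v} X) : JetStage.{u, v} X where
  lower := s.upper
  upper := LinearMap.ker (X.dTilde s.lower ∘ₗ X.J1map s.incl)
  incl := Submodule.subtype _

variable (E : Type (max u v)) [AddCommGroup E] [Module A E]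

/-- The stages `(J^n E, J^(n+1) E, l^{1,n})`, starting from `J^0 E = E`, `J^1 E = J^1 A ⊗_A E` and
`l^{1,0} = id`. -/
noncomputable def jetStage : ℕ → JetStage.{u, v} X
  | 0 => { lower := E, upper := X.J1 E, incl := LinearMap.id }
  | n + 1 => (jetStage n).next

/-- The holonomic jet module `J^n E`. -/
abbrev Jet (n : ℕ) : Type (max u v) := (jetStage.{u, v} X E n).lower

/-- The natural map `l^{1,n} : J^(n+1) E → J^1 J^n E`. -/
noncomputable def jetIncl (n : ℕ) : Jet.{u, v} X E (n + 1) →ₗ[A] X.J1 (Jet.{u, v} X E n) :=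
  (jetStage.{u, v} X E n).incl

/-- The jet projection `π^{n+1,n} = π^{1,0} ∘ l^{1,n} : J^(n+1) E → J^n E`. -/
noncomputable def jetProj (n : ℕ) : Jet.{u, v} X E (n + 1) →ₗ[A] Jet.{u, v} X E n :=
  X.proj10 (Jet.{u, v} X E n) ∘ₗ jetIncl.{u, v} X E n

/-- The Spencer operator `S^{n+1,m} : Ω^m J^(n+1) E → Ω^(m+1) J^n E`,
`ω ⊗ ∑ [y_j ⊗ z_j] ⊗ ξ_j ↦ ∑ d(ω y_j) z_j ⊗ ξ_j`, where the element `∑ [y_j ⊗ z_j] ⊗ ξ_j` of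
`J^1 J^n E` is the image under `l^{1,n}` of an element of `J^(n+1) E`. -/
noncomputable def spencer (n m : ℕ) :
    X.FormT (Jet.{u, v} X E (n + 1)) m →+ X.FormT (Jet.{u, v} X E n) (m + 1) :=
  (X.spencer1 (Jet.{u, v} X E n) m).comp
    (Tensor.mapRight (X.Form m) (jetIncl.{u, v} X E n)).toAddMonoidHom

/-- The operator `S^{n+1,0}` on `J^(n+1) E`, identified with `Ω^0 J^(n+1) E = A ⊗_A J^(n+1) E`
through `ξ ↦ 1 ⊗ ξ`. -/
noncomputable def spencerZero (n : ℕ) :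
    Jet.{u, v} X E (n + 1) →+ X.FormT (Jet.{u, v} X E n) 1 :=
  (spencer.{u, v} X E n 0).comp (Tensor.tmulHom (1 : X.Form 0))

/-! ### Higher order connections -/

/-- An `(n+1)`-connection on `E`: a left `A`-linear section `C : J^n E → J^(n+1) E` of the jet
projection `π^{n+1,n}`. -/
structure HigherConnection (n : ℕ) where
  /-- the section -/
  map : Jet.{u, v} X E n →ₗ[A] Jet.{u, v} X E (n + 1)
  proj_map : jetProj.{u, v} X E n ∘ₗ map = LinearMap.id

namespace HigherConnection

variable {X E} {n : ℕ} (C : HigherConnection.{u, v} X E n)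

/-- The curvature `R_C = - D̃^II ∘ J^1(l^{1,n}) ∘ J^1(C) ∘ l^{1,n} ∘ C : J^n E → Ω^2 J^n E`. -/
noncomputable def curvature : Jet.{u, v} X E n →+ X.FormT (Jet.{u, v} X E n) 2 :=
  -((X.dTildeII (Jet.{u, v} X E n)).comp
    (X.J1map (jetIncl.{u, v} X E n) ∘ₗ X.J1map C.map ∘ₗ jetIncl.{u, v} X E n ∘ₗ
      C.map).toAddMonoidHom)

/-- The associated connection `∇^C = S^{n+1,0} ∘ C : J^n E → Ω^1 J^n E`. -/
noncomputable def nabla : Jet.{u, v} X E n →+ X.FormT (Jet.{u, v} X E n) 1 :=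
  (spencerZero.{u, v} X E n).comp C.map.toAddMonoidHom

/-- The exterior covariant derivative `d_C = S^{n+1,m} ∘ Ω^m(C) : Ω^m J^n E → Ω^(m+1) J^n E`. -/
noncomputable def extDeriv (m : ℕ) :
    X.FormT (Jet.{u, v} X E n) m →+ X.FormT (Jet.{u, v} X E n) (m + 1) :=
  (spencer.{u, v} X E n m).comp (Tensor.mapRight (X.Form m) C.map).toAddMonoidHom

/-- The curvature `R_∇ = d_C ∘ ∇^C : J^n E → Ω^2 J^n E` of the associated connection. -/
noncomputable def nablaCurvature : Jet.{u, v} X E n →+ X.FormT (Jet.{u, v} X E n) 2 :=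
  (C.extDeriv 1).comp C.nabla

end HigherConnection

end ExteriorCalculus

end NCJet

/-!
A higher order connection `C` enters its curvature and its covariant derivative only through the
linear section `D = l ∘ C` of `π^{1,0}`. The identity `S^{1,1} ∘ S^{1,0} = -D̃^II` on `J^1 J^1 N`,
together with the naturality of `S^{1,0}`, gives `-D̃^II ∘ J^1(D) ∘ D = d_D ∘ ∇_D`. The graded
Leibniz rule for `S^{1,m}` and `π^{1,0} ∘ D = id` give
`d_D (ω ∧ τ) = dω ∧ τ + (-1)^m ω ∧ d_D τ`; when it is applied twice to `ω ⊗ ξ`, the terms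
`dω ∧ ∇_D ξ` cancel.
-/

namespace NCJet

namespace Tensor

variable {A : Type*} [Ring A]
  {M : Type*} [AddCommGroup M] [Module A M] [Module Aᵐᵒᵖ M] [SMulCommClass A Aᵐᵒᵖ M]
  {M' : Type*} [AddCommGroup M'] [Module A M'] [Module Aᵐᵒᵖ M'] [SMulCommClass A Aᵐᵒᵖ M']
  {N : Type*} [AddCommGroup N] [Module A N] {N' : Type*} [AddCommGroup N'] [Module A N']
  {N'' : Type*} [AddCommGroup N''] [Module A N'']

theorem hom_ext {G : Type*} [AddCommGroup G] {f g : Tensor A M N →+ G}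
    (h : ∀ m n, f (tmul A m n) = g (tmul A m n)) : f = g := by
  ext t
  induction t using induction_on with
  | zero => rw [map_zero, map_zero]
  | tmul m n => exact h m n
  | add s t hs ht => rw [map_add, map_add, hs, ht]

theorem zsmul_tmul (r : ℤ) (m : M) (n : N) : tmul A (r • m) n = r • tmul A m n :=
  map_zsmul (tmulHom.flip n) r m

theorem mapLeft_id (t : Tensor A M N) : mapLeft N (LinearMap.id : M →ₗ[Aᵐᵒᵖ] M) t = t :=
  DFunLike.congr_fun (hom_ext (f := mapLeft N LinearMap.id) (g := AddMonoidHom.id _)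
    fun _ _ => rfl) t

theorem mapRight_id : mapRight M (LinearMap.id : N →ₗ[A] N) = LinearMap.id :=
  LinearMap.toAddMonoidHom_injective (hom_ext fun _ _ => rfl)

theorem mapRight_comp (ψ : N' →ₗ[A] N'') (φ : N →ₗ[A] N') :
    mapRight M (ψ ∘ₗ φ) = mapRight M ψ ∘ₗ mapRight M φ :=
  LinearMap.toAddMonoidHom_injective (hom_ext fun _ _ => rfl)

theorem mapLeft_mapRight (f : M →ₗ[Aᵐᵒᵖ] M') (φ : N →ₗ[A] N') (t : Tensor A M N) :
    mapLeft N' f (mapRight M φ t) = mapRight M' φ (mapLeft N f t) :=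
  DFunLike.congr_fun (hom_ext (f := (mapLeft N' f).comp (mapRight M φ).toAddMonoidHom)
    (g := (mapRight M' φ).toAddMonoidHom.comp (mapLeft N f)) fun _ _ => rfl) t

end Tensor

namespace ExteriorCalculus

variable {k : Type x} {A : Type u} {Ω : Type w}
  [CommRing k] [Ring A] [Algebra k A] [Ring Ω] [Algebra k Ω]
  {X : ExteriorCalculus k A Ω} {N : Type v} [AddCommGroup N] [Module A N]

namespace Form

variable {m p q : ℕ}

/-- The identity `Ω^m → Ω^q` for `m = q`. It lets the Leibniz rule compare `Ω^((m+1)+p)` with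
`Ω^((m+p)+1)`, which are not definitionally equal for variable `p`. -/
def castDeg (h : m = q) : X.Form m →ₗ[Aᵐᵒᵖ] X.Form q where
  toFun ω := mk ω.val (h ▸ ω.val_mem)
  map_add' _ _ := rfl
  map_smul' _ _ := rfl

theorem diff_diff (ω : X.Form m) : diff (m + 1) (diff m ω) = 0 :=
  ext (X.d_d _)

theorem diff_diffBase (a : A) : diff 1 (diffBase X a) = 0 :=
  ext (X.d_d _)

theorem diff_wedge (ω : X.Form m) (η : X.Form p) :
    diff (m + p) (ω.wedge η) =
      castDeg (Nat.add_right_comm m 1 p) ((diff m ω).wedge η) +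
        (-1 : ℤ) ^ m • (ω.wedge (diff p η) : X.Form (m + (p + 1))) := by
  apply ext
  rw [map_add, map_zsmul]
  exact X.leibniz _ ω.val_mem

end Form

@[elab_as_elim]
theorem J1_induction_on {p : X.J1 N → Prop} (t : X.J1 N) (zero : p 0)
    (cls_tmul : ∀ a b n, p (Tensor.tmul A (J1A.cls X a b) n))
    (add : ∀ s t, p s → p t → p (s + t)) : p t := by
  induction t using Tensor.induction_on with
  | zero => exact zero
  | add s t hs ht => exact add s t hs ht
  | tmul t n =>
    induction t using J1A.induction_on with
    | zero => rwa [Tensor.zero_tmul]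
    | cls a b => exact cls_tmul a b n
    | add s t hs ht => rw [Tensor.add_tmul]; exact add _ _ hs ht

theorem spencer1_wedgeT {m p : ℕ} (ω : X.Form m) (θ : X.FormT (X.J1 N) p) :
    X.spencer1 N (m + p) (wedgeT ω θ) =
      Tensor.mapLeft N (Form.castDeg (Nat.add_right_comm m 1 p))
          (wedgeT (Form.diff m ω) (Tensor.mapRight (X.Form p) (X.proj10 N) θ)) +
        (-1 : ℤ) ^ m • wedgeT ω (X.spencer1 N p θ) := by
  induction θ using Tensor.induction_on with
  | zero => simp
  | add s t hs ht => simp only [map_add, hs, ht, smul_add]; abel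
  | tmul η t =>
    induction t using J1_induction_on with
    | zero => simp
    | add s t hs ht => simp only [Tensor.tmul_add, map_add, hs, ht, smul_add]; abel
    | cls_tmul y z n =>
      have hform : MulOpposite.op z • Form.diff (m + p) (MulOpposite.op y • ω.wedge η) =
          MulOpposite.op (y * z) •
              Form.castDeg (Nat.add_right_comm m 1 p) ((Form.diff m ω).wedge η) +
            (-1 : ℤ) ^ m •
              ω.wedge (MulOpposite.op z • Form.diff p (MulOpposite.op y • η)) := by
        rw [← map_smul ω.wedge, Form.diff_wedge, smul_add, map_smul, map_smul, ← mul_smul,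
          smul_comm _ ((-1 : ℤ) ^ m), map_smul ω.wedge]
        rfl
      rw [wedgeT_tmul, spencer1_tmul, spencer1_tmul, Tensor.mapRight_tmul, proj10_cls, wedgeT_tmul,
        wedgeT_tmul, Tensor.mapLeft_tmul, ← Tensor.op_smul_tmul, ← Tensor.zsmul_tmul, hform]
      exact Tensor.add_tmul (M := X.Form (m + p + 1)) _ _ n

theorem spencer1_tmul_eq {m : ℕ} (ω : X.Form m) (t : X.J1 N) :
    X.spencer1 N m (Tensor.tmul A ω t) =
      Tensor.tmul A (Form.diff m ω) (X.proj10 N t) + (-1 : ℤ) ^ m • wedgeT ω (X.sigma N t) := by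
  have hone {q : ℕ} (η : X.Form q) : η.wedge (1 : X.Form 0) = η := Form.ext (mul_one _)
  have h := spencer1_wedgeT ω (Tensor.tmul A (1 : X.Form 0) t)
  rw [wedgeT_tmul, Tensor.mapRight_tmul, wedgeT_tmul, hone, hone] at h
  exact h

theorem spencer1_sigma (t : X.J1 (X.J1 N)) :
    X.spencer1 N 1 (X.sigma (X.J1 N) t) = -X.dTildeII N t := by
  induction t using J1_induction_on with
  | zero => simp
  | add s t hs ht => simp only [map_add, hs, ht, neg_add]
  | cls_tmul a b ξ =>
    rw [sigma_cls, Tensor.op_smul_tmul, spencer1_tmul_eq, Form.diff_diffBase, Tensor.zero_tmul,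
      zero_add, pow_one, neg_one_zsmul, dTildeII_cls]
    rfl

theorem sigma_J1map {N' : Type*} [AddCommGroup N'] [Module A N'] (φ : N →ₗ[A] N') (t : X.J1 N) :
    X.sigma N' (X.J1map φ t) = Tensor.mapRight (X.Form 1) φ (X.sigma N t) :=
  Tensor.mapLeft_mapRight _ φ t

variable (X) in
/-- The exterior covariant derivative `d_D = S^{1,m} ∘ Ω^m(D) : Ω^m N → Ω^(m+1) N` of an `A`-linear
map `D : N → J^1 N`; a section `D` of `π^{1,0}` is a `1`-connection on `N`. -/
noncomputable def covDeriv (D : N →ₗ[A] X.J1 N) (m : ℕ) : X.FormT N m →+ X.FormT N (m + 1) :=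
  (X.spencer1 N m).comp (Tensor.mapRight (X.Form m) D).toAddMonoidHom

variable (X) in
/-- The connection `∇_D = S^{1,0} ∘ D : N → Ω^1 N` associated with `D`; here `S^{1,0}` is
`sigma`. -/
noncomputable def assocConn (D : N →ₗ[A] X.J1 N) : N →+ X.FormT N 1 :=
  (X.sigma N).comp D.toAddMonoidHom

variable (X) in
/-- The curvature `R_D = -D̃^II ∘ J^1(D) ∘ D : N → Ω^2 N` of an `A`-linear map `D : N → J^1 N`. -/
noncomputable def jetCurvature (D : N →ₗ[A] X.J1 N) : N →+ X.FormT N 2 :=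
  -(X.dTildeII N).comp (X.J1map D ∘ₗ D).toAddMonoidHom

theorem jetCurvature_eq_covDeriv_comp (D : N →ₗ[A] X.J1 N) :
    X.jetCurvature D = (X.covDeriv D 1).comp (X.assocConn D) := by
  ext ξ
  calc -X.dTildeII N (X.J1map D (D ξ))
      = X.spencer1 N 1 (X.sigma (X.J1 N) (X.J1map D (D ξ))) := (spencer1_sigma _).symm
    _ = X.covDeriv D 1 (X.sigma N (D ξ)) := congrArg _ (sigma_J1map D (D ξ))

section LinearSection

variable {D : N →ₗ[A] X.J1 N} (hD : X.proj10 N ∘ₗ D = LinearMap.id)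
include hD

theorem covDeriv_tmul {m : ℕ} (ω : X.Form m) (ξ : N) :
    X.covDeriv D m (Tensor.tmul A ω ξ) =
      Tensor.tmul A (Form.diff m ω) ξ + (-1 : ℤ) ^ m • wedgeT ω (X.assocConn D ξ) := by
  refine (spencer1_tmul_eq ω (D ξ)).trans ?_
  rw [show X.proj10 N (D ξ) = ξ from LinearMap.congr_fun hD ξ]
  rfl

theorem covDeriv_wedgeT {m p : ℕ} (ω : X.Form m) (τ : X.FormT N p) :
    X.covDeriv D (m + p) (wedgeT ω τ) =
      Tensor.mapLeft N (Form.castDeg (Nat.add_right_comm m 1 p)) (wedgeT (Form.diff m ω) τ) +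
        (-1 : ℤ) ^ m • wedgeT ω (X.covDeriv D p τ) := by
  have hπ : Tensor.mapRight (X.Form p) (X.proj10 N) (Tensor.mapRight (X.Form p) D τ) = τ := by
    rw [← LinearMap.comp_apply, ← Tensor.mapRight_comp, hD, Tensor.mapRight_id, LinearMap.id_apply]
  calc X.covDeriv D (m + p) (wedgeT ω τ)
      = X.spencer1 N (m + p) (wedgeT ω (Tensor.mapRight (X.Form p) D τ)) :=
        congrArg _ (Tensor.mapLeft_mapRight ω.wedge D τ).symm
    _ = _ := by rw [spencer1_wedgeT, hπ]; rfl

theorem covDeriv_covDeriv_tmul {m : ℕ} (ω : X.Form m) (ξ : N) :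
    X.covDeriv D (m + 1) (X.covDeriv D m (Tensor.tmul A ω ξ)) =
      wedgeT ω (X.covDeriv D 1 (X.assocConn D ξ)) := by
  have hdω : X.covDeriv D (m + 1) (Tensor.tmul A (Form.diff m ω) ξ) =
      (-1 : ℤ) ^ (m + 1) • wedgeT (Form.diff m ω) (X.assocConn D ξ) := by
    rw [covDeriv_tmul hD, Form.diff_diff, Tensor.zero_tmul, zero_add]
  have hω : X.covDeriv D (m + 1) (wedgeT ω (X.assocConn D ξ)) =
      wedgeT (Form.diff m ω) (X.assocConn D ξ) +
        (-1 : ℤ) ^ m • wedgeT ω (X.covDeriv D 1 (X.assocConn D ξ)) := by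
    rw [covDeriv_wedgeT hD]
    -- For `p = 1` both degrees are `m + 2`, so `castDeg` is the identity by definition.
    exact congrArg (· + _) (Tensor.mapLeft_id _)
  calc X.covDeriv D (m + 1) (X.covDeriv D m (Tensor.tmul A ω ξ))
      = (-1 : ℤ) ^ (m + 1) • wedgeT (Form.diff m ω) (X.assocConn D ξ) +
          (-1 : ℤ) ^ m • (wedgeT (Form.diff m ω) (X.assocConn D ξ) +
            (-1 : ℤ) ^ m • wedgeT ω (X.covDeriv D 1 (X.assocConn D ξ))) := by
        rw [covDeriv_tmul hD, map_add, map_zsmul, hdω, hω]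
    _ = wedgeT ω (X.covDeriv D 1 (X.assocConn D ξ)) := by
        rw [smul_add, smul_smul, ← mul_pow, neg_one_mul, neg_neg, one_pow, one_smul, pow_succ,
          mul_neg_one, neg_smul, neg_add_cancel_left]

end LinearSection

namespace HigherConnection

variable {E : Type (max u v)} [AddCommGroup E] [Module A E] {n : ℕ}
  (C : HigherConnection.{u, v} X E n)

theorem extDeriv_eq_covDeriv (m : ℕ) :
    C.extDeriv m = X.covDeriv (jetIncl.{u, v} X E n ∘ₗ C.map) m := by
  rw [covDeriv, Tensor.mapRight_comp]
  rfl

theorem curvature_eq_jetCurvature :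
    C.curvature = X.jetCurvature (jetIncl.{u, v} X E n ∘ₗ C.map) := by
  rw [jetCurvature, J1map, Tensor.mapRight_comp]
  rfl

end HigherConnection

end ExteriorCalculus

end NCJet

theorem proposition4p14_general {k : Type x} {A : Type u} {Ω : Type w}
    [CommRing k] [Ring A] [Algebra k A] [Ring Ω] [Algebra k Ω]
    (X : NCJet.ExteriorCalculus k A Ω) {N : Type v} [AddCommGroup N] [Module A N]
    (D : N →ₗ[A] X.J1 N) (hD : X.proj10 N ∘ₗ D = LinearMap.id) :
    X.jetCurvature D = (X.covDeriv D 1).comp (X.assocConn D) ∧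
    ∀ (m : ℕ) (ω : X.Form m) (ξ : N),
      X.covDeriv D (m + 1) (X.covDeriv D m (NCJet.Tensor.tmul A ω ξ)) =
        NCJet.ExteriorCalculus.wedgeT ω (X.jetCurvature D ξ) := by
  refine ⟨NCJet.ExteriorCalculus.jetCurvature_eq_covDeriv_comp D, fun m ω ξ => ?_⟩
  rw [NCJet.ExteriorCalculus.covDeriv_covDeriv_tmul hD,
    NCJet.ExteriorCalculus.jetCurvature_eq_covDeriv_comp]
  rfl

theorem proposition4p14 {k : Type x} {A : Type u} {Ω : Type w}
    [CommRing k] [Ring A] [Algebra k A] [Ring Ω] [Algebra k Ω]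
    (X : NCJet.ExteriorCalculus k A Ω)
    (E : Type (max u v)) [AddCommGroup E] [Module A E]
    (n : ℕ) (C : NCJet.ExteriorCalculus.HigherConnection.{u, v} X E n) :
    C.curvature = C.nablaCurvature ∧
    ∀ (m : ℕ) (ω : X.Form m) (ξ : NCJet.ExteriorCalculus.Jet.{u, v} X E n),
      C.extDeriv (m + 1) (C.extDeriv m (NCJet.Tensor.tmul A ω ξ)) =
        NCJet.ExteriorCalculus.wedgeT ω (C.curvature ξ) := by
  rw [NCJet.ExteriorCalculus.HigherConnection.nablaCurvature]
  simp only [C.extDeriv_eq_covDeriv, C.curvature_eq_jetCurvature]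
  exact proposition4p14_general X _ C.proj_map
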